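/- Let $E$ be a complex Banach space, $E_{\mathbb R}$ its underlying real Banach space, and $(E_{\mathbb R})^*$ the dual of $E_{\mathbb R}$. Let $\mathrm{FBL}[E_{\mathbb R}]$ be the smallest closed vector sublattice, containing all evaluations $\delta_{E_{\mathbb R}}(x):x^*\mapsto x^*(x)$ ($x\in E$), of the Banach lattice of positively homogeneous functions $f:(E_{\mathbb R})^*\to\mathbb R$ (with the pointwise order) for which $$\|f\|_{\mathrm{FBL}[E_{\mathbb R}]}=\sup\Big\{\sum_{i=1}^n|f(x_i^*)|:\ n\in\mathbb N,\ x_1^*,\dots,x_n^*\in (E_{\mathbb R})^*,\ \sup_{\|x\|\le1}\sum_{i=1}^n|x_i^*(x)|\le1\Big\}<\infty .$$ The free complex Banach lattice is $\mathrm{FBL}_{\mathbb C}[E]=\mathrm{FBL}[E_{\mathbb R}]\oplus i\,\mathrm{FBL}[E_{\mathbb R}]$, regarded as a space of complex-valued functions on $(E_{\mathbb R})^*$, with the norm $$\|h\|=\sup\Big\{\sum_{j=1}^m|h(\mathrm{Re}\,z_j^*)|:\ m\in\mathbb N,\ z_1^*,\dots,z_m^*\in E^*,\ \sup_{\|z\|\le1}\sum_{j=1}^m|z_j^*(z)|\le1\Big\},$$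 and with the $\mathbb C$-linear map $\delta_E:E\to\mathrm{FBL}_{\mathbb C}[E]$, $\delta_E(z)=\delta_{E_{\mathbb R}}(z)-i\,\delta_{E_{\mathbb R}}(iz)$. A lattice homomorphism of $\mathrm{FBL}_{\mathbb C}[E]$ is a bounded operator of the form $f+ig\mapsto Sf+iSg$ with $S$ a real-linear lattice homomorphism of $\mathrm{FBL}[E_{\mathbb R}]$. For a bounded linear operator $T$ on a complex normed space, $\sigma(T)$ is its spectrum, $\sigma_p(T)$ the set of its eigenvalues, $\sigma_a(T)$ the set of $\lambda\in\sigma(T)$ such that $\lambda-T$ is not bounded below, and $r(T)=\sup\{|\lambda|:\lambda\in\sigma(T)\}$ (with $r(T)=0$ if $\sigma(T)=\emptyset$). Let $T:E\to E$ be a bounded $\mathbb C$-linear operator. There is a unique lattice homomorphism $\overline T:\mathrm{FBL}_{\mathbb C}[E]\to\mathrm{FBL}_{\mathbb C}[E]$ with $\overline T\circ\delta_E=\delta_E\circ T$; it satisfies $\|\overline T\|=\|T\|$, and: 1. $\sigma_a(T)\subset\sigma_a(\overline T)$ and $\sigma_p(T)\subset\sigma_p(\overline T)$; 2. $0\in\sigma(T)$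 if and only if $0\in\sigma(\overline T)$; 3. $r(\overline T)=r(T)$. -/

import Mathlib

open scoped ENNReal

noncomputable section

namespace FreeBanachLattice

section Real

variable (X : Type*) [NormedAddCommGroup X] [NormedSpace ℝ X]

/-- The (possibly infinite) quantity `‖f‖_{FBL[X]}` of a function `f : X* → ℝ`: the supremum of
`∑ |f (x_i*)|` over all finite families in `X*` with `sup_{x ∈ B_X} ∑ |x_i* x| ≤ 1`. -/
def realENorm (f : StrongDual ℝ X → ℝ) : ℝ≥0∞ :=
  ⨆ (n : ℕ) (x : Fin n → StrongDual ℝ X) (_ : ∀ v : X, ‖v‖ ≤ 1 → ∑ i, |x i v| ≤ 1),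
    ∑ i, ‖f (x i)‖ₑ

variable {X}

theorem sum_le_realENorm (f : StrongDual ℝ X → ℝ) {n : ℕ} (x : Fin n → StrongDual ℝ X)
    (hx : ∀ v : X, ‖v‖ ≤ 1 → ∑ i, |x i v| ≤ 1) : ∑ i, ‖f (x i)‖ₑ ≤ realENorm X f :=
  le_iSup_of_le n (le_iSup_of_le x (le_iSup_of_le hx le_rfl))

theorem realENorm_le {f : StrongDual ℝ X → ℝ} {C : ℝ≥0∞}
    (h : ∀ (n : ℕ) (x : Fin n → StrongDual ℝ X), (∀ v : X, ‖v‖ ≤ 1 → ∑ i, |x i v| ≤ 1) →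
      ∑ i, ‖f (x i)‖ₑ ≤ C) : realENorm X f ≤ C :=
  iSup_le fun n => iSup_le fun x => iSup_le fun hx => h n x hx

theorem realENorm_add_le (f g : StrongDual ℝ X → ℝ) :
    realENorm X (f + g) ≤ realENorm X f + realENorm X g := by
  refine realENorm_le fun n x hx => ?_
  calc ∑ i, ‖(f + g) (x i)‖ₑ ≤ ∑ i, (‖f (x i)‖ₑ + ‖g (x i)‖ₑ) :=
        Finset.sum_le_sum fun i _ => enorm_add_le _ _
    _ = _ := Finset.sum_add_distrib
    _ ≤ _ := add_le_add (sum_le_realENorm f x hx) (sum_le_realENorm g x hx)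

theorem realENorm_smul_le (c : ℝ) (f : StrongDual ℝ X → ℝ) :
    realENorm X (c • f) ≤ ‖c‖ₑ * realENorm X f := by
  refine realENorm_le fun n x hx => ?_
  calc ∑ i, ‖(c • f) (x i)‖ₑ = ‖c‖ₑ * ∑ i, ‖f (x i)‖ₑ := by
        simp [Finset.mul_sum, enorm_mul]
    _ ≤ _ := by gcongr; exact sum_le_realENorm f x hx

theorem realENorm_sup_le (f g : StrongDual ℝ X → ℝ) :
    realENorm X (f ⊔ g) ≤ realENorm X f + realENorm X g := by
  refine realENorm_le fun n x hx => ?_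
  calc ∑ i, ‖(f ⊔ g) (x i)‖ₑ ≤ ∑ i, (‖f (x i)‖ₑ + ‖g (x i)‖ₑ) := by
        refine Finset.sum_le_sum fun i _ => ?_
        rcases max_choice (f (x i)) (g (x i)) with h | h
        · simp [h]
        · simp [h]
    _ = _ := Finset.sum_add_distrib
    _ ≤ _ := add_le_add (sum_le_realENorm f x hx) (sum_le_realENorm g x hx)

variable (X)

/-- `H₁[X]`: the positively homogeneous functions `f : X* → ℝ` with `‖f‖_{FBL[X]} < ∞`. -/
def H₁ : Submodule ℝ (StrongDual ℝ X → ℝ) where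
  carrier := {f | (∀ c : ℝ, 0 ≤ c → ∀ x, f (c • x) = c * f x) ∧ realENorm X f < ∞}
  add_mem' := by
    rintro f g ⟨hf, hf'⟩ ⟨hg, hg'⟩
    refine ⟨fun c hc x => ?_, (realENorm_add_le f g).trans_lt (ENNReal.add_lt_top.2 ⟨hf', hg'⟩)⟩
    simp [hf c hc, hg c hc, mul_add]
  zero_mem' := by
    refine ⟨fun c hc x => by simp, lt_of_le_of_lt (realENorm_le (C := 0) ?_) (by simp)⟩
    intro n x hx
    simp
  smul_mem' := by
    rintro c f ⟨hf, hf'⟩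
    refine ⟨fun d hd x => ?_,
      (realENorm_smul_le c f).trans_lt (ENNReal.mul_lt_top enorm_lt_top hf')⟩
    simp [hf d hd, mul_left_comm]

variable {X}

/-- The evaluation function `δ_x : X* → ℝ`, `δ_x(x*) = x*(x)`. -/
def evalFn (x : X) : StrongDual ℝ X → ℝ := fun φ => φ x

/-- `S` is a norm-closed vector sublattice of `H₁[X]` (with the pointwise order). -/
structure IsClosedSublattice (S : Submodule ℝ (StrongDual ℝ X → ℝ)) : Prop where
  le_H₁ : S ≤ H₁ X
  sup_mem : ∀ f ∈ S, ∀ g ∈ S, f ⊔ g ∈ S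
  closed : ∀ f ∈ H₁ X, (∀ ε : ℝ≥0∞, 0 < ε → ∃ g ∈ S, realENorm X (f - g) < ε) → f ∈ S

variable (X)

/-- The real free Banach lattice `FBL[X]`: the smallest closed sublattice of `H₁[X]` containing
all the evaluation functions. -/
def FBL : Submodule ℝ (StrongDual ℝ X → ℝ) :=
  sInf {S | IsClosedSublattice S ∧ ∀ x : X, evalFn x ∈ S}

variable {X}

theorem evalFn_mem_H₁ (x : X) : evalFn x ∈ H₁ X := by
  refine ⟨fun c _ φ => by simp [evalFn], ?_⟩
  refine lt_of_le_of_lt (realENorm_le (C := ENNReal.ofReal ‖x‖) ?_) ENNReal.ofReal_lt_top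
  intro n y hy
  have key : ∑ i, |y i x| ≤ ‖x‖ := by
    rcases eq_or_ne x 0 with rfl | hx
    · simp
    have hx' : 0 < ‖x‖ := norm_pos_iff.2 hx
    have h := hy (‖x‖⁻¹ • x) (by rw [norm_smul, norm_inv, norm_norm, inv_mul_cancel₀ hx'.ne'])
    simp only [map_smul, smul_eq_mul, abs_mul, ← Finset.mul_sum, abs_inv, abs_norm] at h
    rwa [inv_mul_le_iff₀ hx', mul_one] at h
  calc ∑ i, ‖evalFn x (y i)‖ₑ = ENNReal.ofReal (∑ i, |y i x|) := by
        rw [ENNReal.ofReal_sum_of_nonneg fun i _ => abs_nonneg _]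
        simp [evalFn, Real.enorm_eq_ofReal_abs]
    _ ≤ _ := ENNReal.ofReal_le_ofReal key

theorem isClosedSublattice_H₁ : IsClosedSublattice (H₁ X) where
  le_H₁ := le_rfl
  sup_mem := by
    rintro f ⟨hf, hf'⟩ g ⟨hg, hg'⟩
    refine ⟨fun c hc x => ?_, (realENorm_sup_le f g).trans_lt (ENNReal.add_lt_top.2 ⟨hf', hg'⟩)⟩
    simp [hf c hc, hg c hc, mul_max_of_nonneg _ _ hc]
  closed := fun f hf _ => hf

theorem isClosedSublattice_FBL : IsClosedSublattice (FBL X) where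
  le_H₁ := sInf_le ⟨isClosedSublattice_H₁, evalFn_mem_H₁⟩
  sup_mem := by
    intro f hf g hg
    simp only [FBL, Submodule.mem_sInf, Set.mem_ofPred_eq] at hf hg ⊢
    exact fun S hS => hS.1.sup_mem f (hf S hS) g (hg S hS)
  closed := by
    intro f hf h
    simp only [FBL, Submodule.mem_sInf, Set.mem_ofPred_eq] at h ⊢
    intro S hS
    refine hS.1.closed f hf fun ε hε => ?_
    obtain ⟨g, hg, hg'⟩ := h ε hε
    exact ⟨g, hg S hS, hg'⟩

theorem evalFn_mem_FBL (x : X) : evalFn x ∈ FBL X := by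
  simp only [FBL, Submodule.mem_sInf, Set.mem_ofPred_eq]
  exact fun S hS => hS.2 x

/-- `FBL[X]` is a vector lattice for the pointwise order. -/
instance : Lattice (FBL X) :=
  Subtype.lattice (fun {f g} hf hg => isClosedSublattice_FBL.sup_mem f hf g hg)
    (fun {f g} hf hg => by
      have h := (FBL X).neg_mem (isClosedSublattice_FBL.sup_mem (-f) ((FBL X).neg_mem hf) (-g)
        ((FBL X).neg_mem hg))
      have e : -(-f ⊔ -g) = f ⊓ g := by
        rw [neg_sup, neg_neg, neg_neg]
      rwa [e] at h)

end Real

section Complex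

variable {E : Type*} [NormedAddCommGroup E] [NormedSpace ℂ E]

/-- The real part `Re z* ∈ (E_ℝ)*` of a functional `z* ∈ E*`. -/
def rePart (z : StrongDual ℂ E) : StrongDual ℝ E :=
  Complex.reCLM.comp (z.restrictScalars ℝ)

/-- The (possibly infinite) quantity `‖h‖_{FBL_ℂ[E]}` of a function `h : (E_ℝ)* → ℂ`: the supremum
of `∑ |h (Re z_j*)|` over all finite families in `E*` with `sup_{z ∈ B_E} ∑ |z_j* z| ≤ 1`. -/
def complexENorm (h : StrongDual ℝ E → ℂ) : ℝ≥0∞ :=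
  ⨆ (m : ℕ) (z : Fin m → StrongDual ℂ E) (_ : ∀ v : E, ‖v‖ ≤ 1 → ∑ j, ‖z j v‖ ≤ 1),
    ∑ j, ‖h (rePart (z j))‖ₑ

theorem sum_le_complexENorm (h : StrongDual ℝ E → ℂ) {m : ℕ} (z : Fin m → StrongDual ℂ E)
    (hz : ∀ v : E, ‖v‖ ≤ 1 → ∑ j, ‖z j v‖ ≤ 1) :
    ∑ j, ‖h (rePart (z j))‖ₑ ≤ complexENorm h :=
  le_iSup_of_le m (le_iSup_of_le z (le_iSup_of_le hz le_rfl))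

theorem complexENorm_le {h : StrongDual ℝ E → ℂ} {C : ℝ≥0∞}
    (H : ∀ (m : ℕ) (z : Fin m → StrongDual ℂ E), (∀ v : E, ‖v‖ ≤ 1 → ∑ j, ‖z j v‖ ≤ 1) →
      ∑ j, ‖h (rePart (z j))‖ₑ ≤ C) : complexENorm h ≤ C :=
  iSup_le fun m => iSup_le fun z => iSup_le fun hz => H m z hz

theorem complexENorm_add_le (f g : StrongDual ℝ E → ℂ) :
    complexENorm (f + g) ≤ complexENorm f + complexENorm g := by
  refine complexENorm_le fun n x hx => ?_
  calc ∑ i, ‖(f + g) (rePart (x i))‖ₑ ≤ ∑ i, (‖f (rePart (x i))‖ₑ + ‖g (rePart (x i))‖ₑ) :=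
        Finset.sum_le_sum fun i _ => enorm_add_le _ _
    _ = _ := Finset.sum_add_distrib
    _ ≤ _ := add_le_add (sum_le_complexENorm f x hx) (sum_le_complexENorm g x hx)

theorem complexENorm_smul (c : ℂ) (f : StrongDual ℝ E → ℂ) :
    complexENorm (c • f) = ‖c‖ₑ * complexENorm f := by
  simp only [complexENorm, ENNReal.mul_iSup, Pi.smul_apply, smul_eq_mul, enorm_mul,
    Finset.mul_sum]

/-- A function whose real and imaginary parts lie in `FBL[E_ℝ]` has finite norm. -/
theorem complexENorm_lt_top {h : StrongDual ℝ E → ℂ} (h₁ : (fun φ => (h φ).re) ∈ FBL E)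
    (h₂ : (fun φ => (h φ).im) ∈ FBL E) : complexENorm h < ∞ := by
  have f₁ := (isClosedSublattice_FBL.le_H₁ h₁).2
  have f₂ := (isClosedSublattice_FBL.le_H₁ h₂).2
  refine lt_of_le_of_lt (complexENorm_le fun m z hz => ?_) (ENNReal.add_lt_top.2 ⟨f₁, f₂⟩)
  have hz' : ∀ v : E, ‖v‖ ≤ 1 → ∑ j, |rePart (z j) v| ≤ 1 := fun v hv =>
    (Finset.sum_le_sum fun j _ => Complex.abs_re_le_norm (z j v)).trans (hz v hv)
  refine le_trans ?_ (add_le_add (sum_le_realENorm _ _ hz') (sum_le_realENorm _ _ hz'))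
  rw [← Finset.sum_add_distrib]
  refine Finset.sum_le_sum fun j _ => ?_
  simp only [← ofReal_norm]
  rw [← ENNReal.ofReal_add (norm_nonneg _) (norm_nonneg _)]
  exact ENNReal.ofReal_le_ofReal (Complex.norm_le_abs_re_add_abs_im _)

theorem rePart_surjective_scaled (φ : StrongDual ℝ E) :
    ∃ (c : ℝ) (z : StrongDual ℂ E), 0 ≤ c ∧ (∀ v : E, ‖v‖ ≤ 1 → ‖z v‖ ≤ 1) ∧
      φ = c • rePart z := by
  let w : StrongDual ℂ E := StrongDual.extendRCLike φ
  have hw : rePart w = φ := by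
    ext v
    exact StrongDual.re_extendRCLike_apply (𝕜 := ℂ) φ v
  have hc : (0 : ℝ) < ‖w‖ + 1 := by positivity
  refine ⟨‖w‖ + 1, ((‖w‖ + 1 : ℝ)⁻¹ : ℂ) • w, hc.le, fun v hv => ?_, ?_⟩
  · have h1 : ‖w v‖ ≤ ‖w‖ + 1 := by
      have := w.le_opNorm v
      nlinarith [norm_nonneg w]
    have h2 : ‖(((‖w‖ + 1 : ℝ) : ℂ))⁻¹‖ = (‖w‖ + 1)⁻¹ := by
      rw [norm_inv, Complex.norm_real, Real.norm_of_nonneg hc.le]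
    rw [_root_.smul_apply, norm_smul, h2]
    rwa [inv_mul_le_iff₀ hc, mul_one]
  · ext v
    have hv : φ v = (w v).re := by rw [← hw]; rfl
    have : (rePart ((((‖w‖ + 1 : ℝ) : ℂ))⁻¹ • w)) v = (‖w‖ + 1)⁻¹ * (w v).re := by
      simp only [rePart, ContinuousLinearMap.comp_apply,
        ContinuousLinearMap.coe_restrictScalars', _root_.smul_apply, smul_eq_mul,
        Complex.reCLM_apply]
      rw [← Complex.ofReal_inv, Complex.re_ofReal_mul]
    rw [_root_.smul_apply, this, hv, smul_eq_mul, mul_inv_cancel_left₀ hc.ne']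

variable (E)

/-- `FBL[E_ℝ] ⊕ i FBL[E_ℝ]`, realized as the space of functions `f + i g : (E_ℝ)* → ℂ` with
`f, g ∈ FBL[E_ℝ]`. -/
def FBLCsub : Submodule ℂ (StrongDual ℝ E → ℂ) where
  carrier := {h | (fun φ => (h φ).re) ∈ FBL E ∧ (fun φ => (h φ).im) ∈ FBL E}
  add_mem' := fun {f g} hf hg => ⟨(FBL E).add_mem hf.1 hg.1, (FBL E).add_mem hf.2 hg.2⟩
  zero_mem' := ⟨(FBL E).zero_mem, (FBL E).zero_mem⟩
  smul_mem' := fun c f hf => by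
    constructor
    · have := (FBL E).sub_mem ((FBL E).smul_mem c.re hf.1) ((FBL E).smul_mem c.im hf.2)
      exact this
    · have := (FBL E).add_mem ((FBL E).smul_mem c.re hf.2) ((FBL E).smul_mem c.im hf.1)
      exact this

/-- The free complex Banach lattice `FBL_ℂ[E]`; its norm is given below. (It is a separate type,
so that it does not inherit the topology of pointwise convergence.) -/
def FBLC : Type _ := FBLCsub E

variable {E}

namespace FBLC

instance : AddCommGroup (FBLC E) := inferInstanceAs (AddCommGroup (FBLCsub E))

instance : Module ℂ (FBLC E) := inferInstanceAs (Module ℂ (FBLCsub E))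

/-- An element of `FBL_ℂ[E]` as a function `(E_ℝ)* → ℂ`. -/
def toFun (h : FBLC E) : StrongDual ℝ E → ℂ := Subtype.val (p := (· ∈ FBLCsub E)) h

theorem toFun_injective : Function.Injective (toFun (E := E)) := Subtype.val_injective

theorem enorm_lt_top (h : FBLC E) : complexENorm h.toFun < ∞ :=
  complexENorm_lt_top h.2.1 h.2.2

theorem eq_zero_of_complexENorm (h : FBLC E) (h0 : complexENorm h.toFun = 0) : h = 0 := by
  apply toFun_injective
  funext φ
  obtain ⟨c, z, hc, hz, rfl⟩ := rePart_surjective_scaled φ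
  have h1 := sum_le_complexENorm h.toFun (fun _ : Fin 1 => z) (by simpa using hz)
  rw [h0] at h1
  have h2 : h.toFun (rePart z) = 0 := by simpa using h1
  have hr := (isClosedSublattice_FBL.le_H₁ h.2.1).1 c hc (rePart z)
  have hi := (isClosedSublattice_FBL.le_H₁ h.2.2).1 c hc (rePart z)
  change (h.toFun (c • rePart z)).re = c * (h.toFun (rePart z)).re at hr
  change (h.toFun (c • rePart z)).im = c * (h.toFun (rePart z)).im at hi
  rw [h2] at hr hi
  change h.toFun (c • rePart z) = 0
  apply Complex.ext
  · simpa using hr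
  · simpa using hi

/-- The norm of `FBL_ℂ[E]`. -/
instance : Norm (FBLC E) := ⟨fun h => (complexENorm h.toFun).toReal⟩

theorem norm_def (h : FBLC E) : ‖h‖ = (complexENorm h.toFun).toReal := rfl

theorem core : NormedSpace.Core ℂ (FBLC E) where
  norm_nonneg _ := ENNReal.toReal_nonneg
  norm_smul c h := by
    have : complexENorm (c • h).toFun = ‖c‖ₑ * complexENorm h.toFun := complexENorm_smul c h.toFun
    simp [norm_def, this, ENNReal.toReal_mul]
  norm_triangle f g := by
    rw [norm_def, norm_def, norm_def,
      ← ENNReal.toReal_add (enorm_lt_top f).ne (enorm_lt_top g).ne]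
    exact ENNReal.toReal_mono (ENNReal.add_lt_top.2 ⟨enorm_lt_top f, enorm_lt_top g⟩).ne
      (complexENorm_add_le f.toFun g.toFun)
  norm_eq_zero_iff h := by
    constructor
    · intro h0
      rw [norm_def, ENNReal.toReal_eq_zero_iff] at h0
      exact eq_zero_of_complexENorm h (h0.resolve_right (enorm_lt_top h).ne)
    · rintro rfl
      have : complexENorm ((0 : ℂ) • (0 : FBLC E)).toFun = 0 := by
        rw [show ((0 : ℂ) • (0 : FBLC E)).toFun = (0 : ℂ) • (0 : FBLC E).toFun from rfl,
          complexENorm_smul]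
        simp
      rw [smul_zero] at this
      simp [norm_def, this]

instance : NormedAddCommGroup (FBLC E) := NormedAddCommGroup.ofCore core

instance : NormedSpace ℂ (FBLC E) := NormedSpace.ofCore core

/-- The element `f + i g` of `FBL_ℂ[E]`, for `f, g ∈ FBL[E_ℝ]`. -/
def mk (f g : FBL E) : FBLC E :=
  ⟨fun φ => ⟨f.1 φ, g.1 φ⟩, f.2, g.2⟩

/-- The canonical embedding `δ_E(z) = δ_{E_ℝ}(z) - i δ_{E_ℝ}(i z)`. -/
def delta : E →ₗ[ℂ] FBLC E where
  toFun z := mk ⟨evalFn z, evalFn_mem_FBL z⟩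
    (-⟨evalFn (Complex.I • z), evalFn_mem_FBL (Complex.I • z)⟩)
  map_add' z w := by
    apply toFun_injective
    funext φ
    apply Complex.ext
    · change φ (z + w) = φ z + φ w
      simp
    · change -φ (Complex.I • (z + w)) = -φ (Complex.I • z) + -φ (Complex.I • w)
      rw [smul_add, map_add, neg_add]
  map_smul' c z := by
    have hcz : c • z = c.re • z + c.im • (Complex.I • z) := by
      conv_lhs => rw [← Complex.re_add_im c, add_smul, mul_smul, Complex.coe_smul,
        Complex.coe_smul]
    have hci : Complex.I • (c • z) = c.re • (Complex.I • z) - c.im • z := by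
      rw [hcz, smul_add, smul_comm, smul_comm Complex.I c.im, smul_smul, Complex.I_mul_I,
        neg_one_smul, smul_neg, sub_eq_add_neg]
    apply toFun_injective
    funext φ
    apply Complex.ext
    · change φ (c • z) = c.re * φ z - c.im * -φ (Complex.I • z)
      rw [hcz, map_add, map_smul, map_smul, smul_eq_mul, smul_eq_mul]
      ring
    · change -φ (Complex.I • (c • z)) = c.re * -φ (Complex.I • z) + c.im * φ z
      rw [hci, map_sub, φ.map_smul, φ.map_smul, smul_eq_mul, smul_eq_mul]
      ring

/-- An operator on `FBL_ℂ[E]` is a (complex) lattice homomorphism if it is the complexification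
`f + i g ↦ S f + i S g` of a real-linear lattice homomorphism `S` of `FBL[E_ℝ]`. -/
def IsLatticeHom (R : FBLC E →L[ℂ] FBLC E) : Prop :=
  ∃ S : FBL E →ₗ[ℝ] FBL E,
    (∀ f g, S (f ⊔ g) = S f ⊔ S g) ∧ (∀ f g, S (f ⊓ g) = S f ⊓ S g) ∧
    ∀ f g, R (mk f g) = mk (S f) (S g)

/-- `R` is a lattice homomorphism of `FBL_ℂ[E]` extending `T`, that is, `R ∘ δ_E = δ_E ∘ T`. -/
def IsInduced (T : E →L[ℂ] E) (R : FBLC E →L[ℂ] FBLC E) : Prop :=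
  IsLatticeHom R ∧ ∀ z : E, R (delta z) = delta (T z)

end FBLC

end Complex

section Spectrum

variable {V : Type*} [NormedAddCommGroup V] [NormedSpace ℂ V]

/-- The point spectrum `σ_p(T)`: the set of eigenvalues. -/
def pointSpectrum (T : V →L[ℂ] V) : Set ℂ :=
  {μ | Module.End.HasEigenvalue (T : V →ₗ[ℂ] V) μ}

/-- The approximate point spectrum `σ_a(T)`: those `μ ∈ σ(T)` for which `μ - T` is not bounded
below. -/
def approxPointSpectrum (T : V →L[ℂ] V) : Set ℂ :=
  {μ | μ ∈ spectrum ℂ T ∧ ¬ ∃ α : ℝ, 0 < α ∧ ∀ v : V, α * ‖v‖ ≤ ‖μ • v - T v‖}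

end Spectrum

end FreeBanachLattice

end

open scoped ENNReal Topology
open Filter

noncomputable section

namespace FreeBanachLattice

/-! ### Composition with an adjoint on the real free Banach lattice -/

section Real

variable {X : Type*} [NormedAddCommGroup X] [NormedSpace ℝ X]

/-! The induced operator is composition with the adjoint, `h ↦ h ∘ T*`. It acts pointwise, so it
respects the lattice operations, and it is bounded by `‖T‖` because `T*` scales weak 1-norms by at
most `‖T‖`. Uniqueness holds because two bounded lattice homomorphisms that agree on evaluations
agree on a closed sublattice, hence everywhere (`IsInduced.eq_induced`).

The spectral claims rest on `δ_E` being an isometry (`norm_delta`) that intertwines `T` and `T̄`. It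
carries eigenvectors to eigenvectors and lower bounds of `μ - T̄` back to `μ - T`, and it gives
`‖T̄‖ = ‖T‖`. As `T ↦ T̄` is multiplicative, `T̄` is invertible when `T` is, and `‖T̄ⁿ‖ = ‖Tⁿ‖`, so
Gelfand's formula equates the spectral radii; this needs `FBL_ℂ[E]` complete. Conversely, let `T̄`
be invertible. Then `T` is bounded below, so its range is closed. A nonzero functional `w` killing
the range would make every `T̄ h` vanish at `Re w`, although `δ_E(v)` takes the value `w v` there.
-/

theorem apply_smul_of_mem_FBL {f : StrongDual ℝ X → ℝ} (hf : f ∈ FBL X) {c : ℝ} (hc : 0 ≤ c)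
    (φ : StrongDual ℝ X) : f (c • φ) = c * f φ :=
  (isClosedSublattice_FBL.le_H₁ hf).1 c hc φ

/-- For a positively homogeneous `f`, the bound on the weak `1`-norm can be rescaled. -/
theorem sum_enorm_le_mul_realENorm {f : StrongDual ℝ X → ℝ}
    (hf : ∀ c : ℝ, 0 ≤ c → ∀ φ, f (c • φ) = c * f φ) {c : ℝ} (hc : 0 < c) {n : ℕ}
    (x : Fin n → StrongDual ℝ X) (hx : ∀ v : X, ‖v‖ ≤ 1 → ∑ i, |x i v| ≤ c) :
    ∑ i, ‖f (x i)‖ₑ ≤ ENNReal.ofReal c * realENorm X f := by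
  have h := sum_le_realENorm f (fun i => c⁻¹ • x i) fun v hv => by
    simp only [_root_.smul_apply, smul_eq_mul, abs_mul, abs_of_pos (inv_pos.2 hc),
      ← Finset.mul_sum]
    rw [inv_mul_le_iff₀ hc, mul_one]
    exact hx v hv
  calc ∑ i, ‖f (x i)‖ₑ = ENNReal.ofReal c * ∑ i, ‖f (c⁻¹ • x i)‖ₑ := by
        rw [Finset.mul_sum]
        refine Finset.sum_congr rfl fun i _ => ?_
        conv_lhs => rw [← smul_inv_smul₀ hc.ne' (x i), hf c hc.le, enorm_mul,
          Real.enorm_eq_ofReal hc.le]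
    _ ≤ _ := by gcongr

/-- Only some finite constant is needed here; `‖T‖ + 1` is positive even for `T = 0`, so one may
rescale by it. -/
theorem comp_mem_H₁ (T : X →L[ℝ] X) {f : StrongDual ℝ X → ℝ} (hf : f ∈ H₁ X) :
    (fun φ => f (φ.comp T)) ∈ H₁ X ∧
      realENorm X (fun φ => f (φ.comp T)) ≤ ENNReal.ofReal (‖T‖ + 1) * realENorm X f := by
  have hle : realENorm X (fun φ => f (φ.comp T)) ≤
      ENNReal.ofReal (‖T‖ + 1) * realENorm X f := by
    refine realENorm_le fun n x hx => ?_
    have hT : 0 < ‖T‖ + 1 := by positivity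
    refine sum_enorm_le_mul_realENorm hf.1 hT (fun i => (x i).comp T) fun v hv => ?_
    have h := hx ((‖T‖ + 1)⁻¹ • T v) (by
      rw [norm_smul, norm_inv, Real.norm_of_nonneg hT.le, inv_mul_le_iff₀ hT, mul_one]
      nlinarith [T.le_opNorm v, norm_nonneg T])
    simp only [map_smul, smul_eq_mul, abs_mul, abs_of_pos (inv_pos.2 hT),
      ← Finset.mul_sum] at h
    rwa [inv_mul_le_iff₀ hT, mul_one] at h
  refine ⟨⟨fun c hc φ => ?_, hle.trans_lt (ENNReal.mul_lt_top ENNReal.ofReal_lt_top hf.2)⟩, hle⟩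
  exact hf.1 c hc (φ.comp T)

/-- An induction principle for the smallest closed sublattice. -/
theorem FBL_le {S : Submodule ℝ (StrongDual ℝ X → ℝ)} (hS : IsClosedSublattice S)
    (h : ∀ x : X, evalFn x ∈ S) : FBL X ≤ S :=
  sInf_le ⟨hS, h⟩

theorem comp_mem_FBL (T : X →L[ℝ] X) {f : StrongDual ℝ X → ℝ} (hf : f ∈ FBL X) :
    (fun φ => f (φ.comp T)) ∈ FBL X := by
  let L : (StrongDual ℝ X → ℝ) →ₗ[ℝ] (StrongDual ℝ X → ℝ) :=
    LinearMap.funLeft ℝ ℝ fun φ : StrongDual ℝ X => φ.comp T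
  -- The functions whose composite with `T*` stays in `FBL X` form a closed sublattice; it contains
  -- the evaluations since `δ_x ∘ T* = δ_{Tx}`.
  have hS : IsClosedSublattice (H₁ X ⊓ (FBL X).comap L) :=
    { le_H₁ := inf_le_left
      sup_mem := fun f hf g hg => ⟨isClosedSublattice_H₁.sup_mem f hf.1 g hg.1,
        isClosedSublattice_FBL.sup_mem _ hf.2 _ hg.2⟩
      closed := by
        refine fun f hf h => ⟨hf, isClosedSublattice_FBL.closed _ (comp_mem_H₁ T hf).1
          fun ε hε => ?_⟩
        have hT : ENNReal.ofReal (‖T‖ + 1) ≠ 0 := by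
          rw [Ne, ENNReal.ofReal_eq_zero, not_le]; positivity
        obtain ⟨g, hg, hgε⟩ := h (ε / ENNReal.ofReal (‖T‖ + 1))
          (ENNReal.div_pos hε.ne' ENNReal.ofReal_ne_top)
        refine ⟨L g, hg.2, ((comp_mem_H₁ T ((H₁ X).sub_mem hf hg.1)).2).trans_lt ?_⟩
        rw [mul_comm]
        exact (ENNReal.lt_div_iff_mul_lt (Or.inl hT) (Or.inl ENNReal.ofReal_ne_top)).1 hgε }
  exact (FBL_le hS (fun x => ⟨evalFn_mem_H₁ x, evalFn_mem_FBL (T x)⟩) hf).2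

/-- A positively homogeneous function approximable by `FBL[X]` belongs to `FBL[X]`. -/
theorem mem_FBL_of_approx {f : StrongDual ℝ X → ℝ} (hf : ∀ c : ℝ, 0 ≤ c → ∀ φ, f (c • φ) = c * f φ)
    (h : ∀ ε : ℝ≥0∞, 0 < ε → ∃ g ∈ FBL X, realENorm X (f - g) < ε) : f ∈ FBL X := by
  refine isClosedSublattice_FBL.closed f ⟨hf, ?_⟩ h
  obtain ⟨g, hg, hfg⟩ := h 1 one_pos
  have := realENorm_add_le (f - g) g
  rw [sub_add_cancel] at this
  exact this.trans_lt (ENNReal.add_lt_top.2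
    ⟨hfg.trans ENNReal.one_lt_top, (isClosedSublattice_FBL.le_H₁ hg).2⟩)

/-- The lattice homomorphism `f ↦ f ∘ T*` of `FBL[X]`. -/
def compFBL (T : X →L[ℝ] X) : FBL X →ₗ[ℝ] FBL X where
  toFun f := ⟨fun φ => f.1 (φ.comp T), comp_mem_FBL T f.2⟩
  map_add' _ _ := rfl
  map_smul' _ _ := rfl

end Real

/-! ### Comparison of the real and complex norms -/

section Complex

variable {E : Type*} [NormedAddCommGroup E] [NormedSpace ℂ E]

theorem rePart_apply (z : StrongDual ℂ E) (v : E) : rePart z v = (z v).re := rfl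

theorem rePart_smul (c : ℝ) (z : StrongDual ℂ E) : rePart (c • z) = c • rePart z := by
  ext v
  simp [rePart_apply]

/-- The weak `1`-norm condition is invariant under dilations. -/
theorem sum_norm_apply_le {m : ℕ} {z : Fin m → StrongDual ℂ E} {c : ℝ}
    (hz : ∀ v : E, ‖v‖ ≤ 1 → ∑ j, ‖z j v‖ ≤ c) (v : E) : ∑ j, ‖z j v‖ ≤ ‖v‖ * c := by
  rcases eq_or_ne v 0 with rfl | hv
  · simp
  have hv' : 0 < ‖v‖ := norm_pos_iff.2 hv
  have h := hz ((‖v‖⁻¹ : ℝ) • v)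
    (by rw [norm_smul, norm_inv, norm_norm, inv_mul_cancel₀ hv'.ne'])
  simp only [ContinuousLinearMap.map_smul_of_tower, norm_smul, norm_inv, norm_norm,
    ← Finset.mul_sum] at h
  rwa [inv_mul_le_iff₀ hv'] at h

theorem complexENorm_le_realENorm (f : StrongDual ℝ E → ℝ) :
    complexENorm (fun φ => (f φ : ℂ)) ≤ realENorm E f := by
  refine complexENorm_le fun m z hz => ?_
  refine le_trans (le_of_eq ?_) (sum_le_realENorm f (fun j => rePart (z j)) fun v hv =>
    (Finset.sum_le_sum fun j _ => Complex.abs_re_le_norm (z j v)).trans (hz v hv))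
  simp [← ofReal_norm]

/-- Rescaling by `c⁻¹` reduces to admissible families. The case `c = 0`, where every `z j` vanishes,
is included so that the sharp constant `‖T‖` can be used for `T = 0` too. -/
theorem sum_enorm_le_mul_complexENorm {h : StrongDual ℝ E → ℂ}
    (hh : ∀ c : ℝ, 0 ≤ c → ∀ φ, h (c • φ) = c * h φ) {c : ℝ} (hc : 0 ≤ c) {m : ℕ}
    (z : Fin m → StrongDual ℂ E) (hz : ∀ v : E, ‖v‖ ≤ 1 → ∑ j, ‖z j v‖ ≤ c) :
    ∑ j, ‖h (rePart (z j))‖ₑ ≤ ENNReal.ofReal c * complexENorm h := by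
  have pos : ∀ d : ℝ, 0 < d → (∀ v : E, ‖v‖ ≤ 1 → ∑ j, ‖z j v‖ ≤ d) →
      ∑ j, ‖h (rePart (z j))‖ₑ ≤ ENNReal.ofReal d * complexENorm h := by
    intro d hd hz
    have key := sum_le_complexENorm h (fun j => d⁻¹ • z j) fun v hv => by
      simp only [_root_.smul_apply, norm_smul, norm_inv, Real.norm_of_nonneg hd.le,
        ← Finset.mul_sum]
      rw [inv_mul_le_iff₀ hd, mul_one]
      exact hz v hv
    calc ∑ j, ‖h (rePart (z j))‖ₑ
        = ENNReal.ofReal d * ∑ j, ‖h (rePart (d⁻¹ • z j))‖ₑ := by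
          rw [Finset.mul_sum]
          refine Finset.sum_congr rfl fun j _ => ?_
          conv_lhs => rw [← smul_inv_smul₀ hd.ne' (z j), rePart_smul, hh d hd.le, enorm_mul]
          rw [← ofReal_norm (d : ℂ), Complex.norm_real, Real.norm_of_nonneg hd.le]
      _ ≤ _ := by gcongr
  rcases hc.eq_or_lt with rfl | hc'
  · have h0 : h 0 = 0 := by simpa using hh 0 le_rfl 0
    have hz0 : ∀ j, z j = 0 := by
      intro j
      ext v
      have h1 := sum_norm_apply_le hz v
      rw [mul_zero] at h1
      exact norm_le_zero_iff.1
        ((Finset.single_le_sum (fun i _ => norm_nonneg (z i v)) (Finset.mem_univ j)).trans h1)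
    simp [hz0, rePart, h0]
  · exact pos c hc' hz

/-- The norm of `FBL[E_ℝ]` is controlled by that of `FBL_ℂ[E]`. -/
theorem realENorm_le_two_mul_complexENorm {f : StrongDual ℝ E → ℝ} {h : StrongDual ℝ E → ℂ}
    (hh : ∀ c : ℝ, 0 ≤ c → ∀ φ, h (c • φ) = c * h φ) (hfh : ∀ φ, |f φ| ≤ ‖h φ‖) :
    realENorm E f ≤ ENNReal.ofReal 2 * complexENorm h := by
  refine realENorm_le fun n x hx => ?_
  -- Each `x i` is the real part of the complex functional `v ↦ x i v - i x i (iv)`. Its modulus is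
  -- at most `|x i v| + |x i (iv)|`, and each term sums to at most 1: this is the factor 2.
  have hre : ∀ i, rePart (StrongDual.extendRCLike (𝕜 := ℂ) (x i)) = x i := fun i => by
    ext v
    exact StrongDual.re_extendRCLike_apply (𝕜 := ℂ) (x i) v
  have him : ∀ i v, (StrongDual.extendRCLike (𝕜 := ℂ) (x i) v).im = -x i (Complex.I • v) := by
    intro i v
    have h1 := congrArg (fun ψ => ψ (Complex.I • v)) (hre i)
    simp only [rePart_apply, map_smul, smul_eq_mul, Complex.I_mul_re] at h1
    rw [← h1, neg_neg]
  refine le_trans (Finset.sum_le_sum fun i _ => ?_) (sum_enorm_le_mul_complexENorm hh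
    (by norm_num) (fun i => StrongDual.extendRCLike (𝕜 := ℂ) (x i)) fun v hv => ?_)
  · rw [hre, ← ofReal_norm, ← ofReal_norm]
    exact ENNReal.ofReal_le_ofReal (hfh _)
  · calc ∑ i, ‖StrongDual.extendRCLike (𝕜 := ℂ) (x i) v‖
        ≤ ∑ i, (|x i v| + |x i (Complex.I • v)|) := by
          refine Finset.sum_le_sum fun i _ => (Complex.norm_le_abs_re_add_abs_im _).trans ?_
          rw [him, abs_neg, ← rePart_apply, hre]
      _ = ∑ i, |x i v| + ∑ i, |x i (Complex.I • v)| := Finset.sum_add_distrib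
      _ ≤ 1 + 1 := add_le_add (hx v hv) (hx _ (by rwa [norm_smul, Complex.norm_I, one_mul]))
      _ = 2 := by norm_num

/-! ### Completeness, the isometric embedding and the induced operator -/

namespace FBLC

theorem toFun_smul_arg (h : FBLC E) {c : ℝ} (hc : 0 ≤ c) (φ : StrongDual ℝ E) :
    h.toFun (c • φ) = c * h.toFun φ := by
  apply Complex.ext
  · rw [Complex.re_ofReal_mul]
    exact apply_smul_of_mem_FBL h.2.1 hc φ
  · rw [Complex.im_ofReal_mul]
    exact apply_smul_of_mem_FBL h.2.2 hc φ

theorem complexENorm_toFun (h : FBLC E) : complexENorm h.toFun = ENNReal.ofReal ‖h‖ :=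
  (ENNReal.ofReal_toReal (enorm_lt_top h).ne).symm

theorem norm_le_of_complexENorm_le {h : FBLC E} {C : ℝ} (hC : 0 ≤ C)
    (hle : complexENorm h.toFun ≤ ENNReal.ofReal C) : ‖h‖ ≤ C :=
  ENNReal.toReal_le_of_le_ofReal hC hle

/-- Every point evaluation is bounded for the norm of `FBL_ℂ[E]`. -/
theorem exists_norm_toFun_le (φ : StrongDual ℝ E) :
    ∃ C : ℝ, ∀ h : FBLC E, ‖h.toFun φ‖ ≤ C * ‖h‖ := by
  obtain ⟨c, z, hc, hz, rfl⟩ := rePart_surjective_scaled φ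
  refine ⟨c, fun h => ?_⟩
  have h1 := sum_le_complexENorm h.toFun (fun _ : Fin 1 => z) (by simpa using hz)
  rw [complexENorm_toFun, Fin.sum_univ_one, ← ofReal_norm,
    ENNReal.ofReal_le_ofReal_iff (norm_nonneg _)] at h1
  rw [toFun_smul_arg h hc, norm_mul, Complex.norm_real, Real.norm_of_nonneg hc]
  gcongr

/-- Evaluation at a point of `(E_ℝ)*`, as a bounded functional on `FBL_ℂ[E]`. -/
def eval (φ : StrongDual ℝ E) : FBLC E →L[ℂ] ℂ :=
  LinearMap.mkContinuousOfExistsBound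
    { toFun := fun h => h.toFun φ
      map_add' := fun _ _ => rfl
      map_smul' := fun _ _ => rfl } (exists_norm_toFun_le φ)

/-- Point evaluations are bounded, so a Cauchy sequence has a pointwise limit. Its real and
imaginary parts lie in `FBL E` because the real norm is at most twice the complex one. -/
instance : CompleteSpace (FBLC E) := by
  refine Metric.complete_of_cauchySeq_tendsto fun u hu => ?_
  choose h hlim using fun φ =>
    cauchySeq_tendsto_of_complete ((eval (E := E) φ).uniformContinuous.comp_cauchySeq hu)
  have hlim' : ∀ φ, Tendsto (fun n => (u n).toFun φ) atTop (𝓝 (h φ)) := hlim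
  have hom : ∀ c : ℝ, 0 ≤ c → ∀ φ, h (c • φ) = c * h φ := fun c hc φ => by
    refine tendsto_nhds_unique (hlim' (c • φ)) ?_
    simp only [toFun_smul_arg _ hc]
    exact (hlim' φ).const_mul _
  -- Lower semicontinuity: each finite sum defining the norm passes to the pointwise limit.
  have key : ∀ ε : ℝ, 0 < ε → ∃ N, ∀ n ≥ N,
      complexENorm (h - (u n).toFun) ≤ ENNReal.ofReal ε := by
    intro ε hε
    obtain ⟨N, hN⟩ := Metric.cauchySeq_iff.1 hu ε hε
    refine ⟨N, fun n hn => complexENorm_le fun k z hz => ?_⟩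
    refine le_of_tendsto (tendsto_finsetSum _ fun j _ =>
      (((hlim' (rePart (z j))).sub_const ((u n).toFun (rePart (z j)))).enorm)) ?_
    filter_upwards [eventually_ge_atTop N] with m hm
    refine (sum_le_complexENorm (u m - u n).toFun z hz).trans ?_
    rw [complexENorm_toFun]
    refine ENNReal.ofReal_le_ofReal ?_
    rw [← dist_eq_norm]
    exact (hN m hm n hn).le
  -- `ρ` stands for `Re` and `Im`, handled together.
  have approx : ∀ ρ : ℂ →L[ℝ] ℝ, (∀ w, |ρ w| ≤ ‖w‖) →
      (∀ k : FBLC E, (fun φ => ρ (k.toFun φ)) ∈ FBL E) → (fun φ => ρ (h φ)) ∈ FBL E := by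
    intro ρ hρ hmem
    refine mem_FBL_of_approx (fun c hc φ => ?_) fun ε hε => ?_
    · simp only [hom c hc φ]
      rw [← Complex.real_smul, map_smul, smul_eq_mul]
    · obtain ⟨δ, hδ, hδε⟩ := ENNReal.lt_iff_exists_nnreal_btwn.1 hε
      have hδ' : (0 : ℝ) < δ / 3 := by
        have : (0 : ℝ) < δ := by exact_mod_cast hδ
        positivity
      obtain ⟨N, hN⟩ := key (δ / 3) hδ'
      refine ⟨_, hmem (u N), lt_of_le_of_lt ?_ hδε⟩
      refine (realENorm_le_two_mul_complexENorm (h := h - (u N).toFun)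
        (fun c hc φ => ?_) fun φ => ?_).trans ?_
      · simp only [Pi.sub_apply, hom c hc, toFun_smul_arg _ hc, mul_sub]
      · simp only [Pi.sub_apply, ← map_sub]
        exact hρ _
      · refine (mul_le_mul_right (hN N le_rfl) _).trans ?_
        rw [← ENNReal.ofReal_mul (by norm_num), ← ENNReal.ofReal_coe_nnreal]
        refine ENNReal.ofReal_le_ofReal ?_
        linarith
  let H : FBLC E := ⟨h, approx Complex.reCLM Complex.abs_re_le_norm fun k => k.2.1,
    approx Complex.imCLM Complex.abs_im_le_norm fun k => k.2.2⟩
  refine ⟨H, Metric.tendsto_atTop.2 fun ε hε => ?_⟩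
  obtain ⟨N, hN⟩ := key (ε / 2) (by positivity)
  refine ⟨N, fun n hn => ?_⟩
  rw [dist_comm, dist_eq_norm]
  exact (norm_le_of_complexENorm_le (h := H - u n) (by positivity) (hN n hn)).trans_lt
    (half_lt_self hε)

theorem toFun_delta_rePart (z : E) (w : StrongDual ℂ E) :
    (delta z).toFun (rePart w) = w z := by
  apply Complex.ext
  · rfl
  · change -(w (Complex.I • z)).re = (w z).im
    simp

/-- At `Re w` the function `δ_E(z)` takes the value `w z`, so the upper bound is the weak 1-norm
condition itself; a norming functional from Hahn–Banach gives the lower bound. -/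
theorem norm_delta (z : E) : ‖delta z‖ = ‖z‖ := by
  refine le_antisymm (norm_le_of_complexENorm_le (norm_nonneg z) ?_) ?_
  · refine complexENorm_le fun m w hw => ?_
    simp only [toFun_delta_rePart, ← ofReal_norm]
    rw [← ENNReal.ofReal_sum_of_nonneg fun _ _ => norm_nonneg _]
    exact ENNReal.ofReal_le_ofReal ((sum_norm_apply_le hw z).trans_eq (mul_one _))
  · obtain ⟨g, hg, hgz⟩ := exists_dual_vector'' ℂ z
    have h1 := sum_le_complexENorm (delta z).toFun (fun _ : Fin 1 => g) fun v hv => by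
      rw [Fin.sum_univ_one]
      exact (g.le_of_opNorm_le hg v).trans (by rwa [one_mul])
    rw [complexENorm_toFun, Fin.sum_univ_one, toFun_delta_rePart, hgz, ← ofReal_norm,
      ENNReal.ofReal_le_ofReal_iff (norm_nonneg _)] at h1
    simpa using h1

theorem delta_injective : Function.Injective (delta (E := E)) := fun z w h => by
  rw [← sub_eq_zero, ← norm_eq_zero, ← norm_delta, map_sub, h, sub_self, norm_zero]

/-- The operator `h ↦ h ∘ T*` of `FBL_ℂ[E]` induced by `T`. -/
def induced (T : E →L[ℂ] E) : FBLC E →L[ℂ] FBLC E :=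
  LinearMap.mkContinuous
    { toFun := fun h => ⟨fun φ => h.toFun (φ.comp (T.restrictScalars ℝ)),
        comp_mem_FBL (T.restrictScalars ℝ) h.2.1, comp_mem_FBL (T.restrictScalars ℝ) h.2.2⟩
      map_add' := fun _ _ => rfl
      map_smul' := fun _ _ => rfl } ‖T‖ fun h => by
    refine norm_le_of_complexENorm_le (by positivity) (complexENorm_le fun m z hz => ?_)
    rw [ENNReal.ofReal_mul (norm_nonneg T), ← complexENorm_toFun]
    refine sum_enorm_le_mul_complexENorm (fun c hc φ => toFun_smul_arg h hc φ) (norm_nonneg T)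
      (fun j => (z j).comp T) fun v hv => ?_
    exact ((sum_norm_apply_le hz (T v)).trans_eq (mul_one _)).trans (T.unit_le_opNorm v hv)

theorem toFun_induced (T : E →L[ℂ] E) (h : FBLC E) (φ : StrongDual ℝ E) :
    (induced T h).toFun φ = h.toFun (φ.comp (T.restrictScalars ℝ)) := rfl

theorem induced_mk (T : E →L[ℂ] E) (f g : FBL E) :
    induced T (mk f g) =
      mk (compFBL (T.restrictScalars ℝ) f) (compFBL (T.restrictScalars ℝ) g) := rfl

theorem induced_delta (T : E →L[ℂ] E) (z : E) : induced T (delta z) = delta (T z) := by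
  apply toFun_injective
  funext φ
  apply Complex.ext
  · rfl
  · change -φ (T (Complex.I • z)) = -φ (Complex.I • T z)
    rw [map_smul]

theorem isInduced_induced (T : E →L[ℂ] E) : IsInduced T (induced T) :=
  ⟨⟨compFBL (T.restrictScalars ℝ), fun _ _ => rfl, fun _ _ => rfl, induced_mk T⟩,
    induced_delta T⟩

/-! ### Uniqueness of the induced homomorphism -/

theorem norm_mk_zero_le (f : FBL E) : ‖mk f 0‖ ≤ (realENorm E f.1).toReal :=
  ENNReal.toReal_mono (isClosedSublattice_FBL.le_H₁ f.2).2.ne (complexENorm_le_realENorm f.1)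

theorem mk_sub_zero (f g : FBL E) : mk (f - g) 0 = mk f 0 - mk g 0 := by
  apply toFun_injective
  funext φ
  apply Complex.ext
  · rfl
  · change (0 : ℝ) = 0 - 0
    simp

theorem mk_left_injective {f g : FBL E} (h : mk f 0 = mk g 0) : f = g := by
  refine Subtype.ext (funext fun φ => ?_)
  exact congrArg (fun k : FBLC E => (k.toFun φ).re) h

theorem IsInduced.eq_induced {T : E →L[ℂ] E} {R : FBLC E →L[ℂ] FBLC E} (hR : IsInduced T R) :
    R = induced T := by
  obtain ⟨⟨S, hsup, -, hS⟩, hδ⟩ := hR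
  set C : FBL E →ₗ[ℝ] FBL E := compFBL (T.restrictScalars ℝ) with hC
  -- No continuity of `S` is assumed; that of `R` replaces it when the agreement set is shown
  -- closed.
  have iff : ∀ f : FBL E, S f = C f ↔ R (mk f 0) = induced T (mk f 0) := fun f => by
    rw [hS, induced_mk, map_zero, map_zero]
    exact ⟨fun h => by rw [h], mk_left_injective⟩
  have hA : IsClosedSublattice ((LinearMap.eqLocus S C).map (FBL E).subtype) :=
    { le_H₁ := by
        rintro _ ⟨f, -, rfl⟩
        exact isClosedSublattice_FBL.le_H₁ f.2
      sup_mem := by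
        rintro _ ⟨f, hf, rfl⟩ _ ⟨g, hg, rfl⟩
        refine ⟨f ⊔ g, ?_, rfl⟩
        have hf' : S f = C f := hf
        have hg' : S g = C g := hg
        change S (f ⊔ g) = C (f ⊔ g)
        rw [hsup, hf', hg']
        rfl
      closed := by
        intro f hf h
        have hfm : f ∈ FBL E := isClosedSublattice_FBL.closed f hf fun ε hε => by
          obtain ⟨_, ⟨g, -, rfl⟩, hg⟩ := h ε hε
          exact ⟨_, g.2, hg⟩
        refine ⟨⟨f, hfm⟩, (iff _).2 ?_, rfl⟩
        have hcl : IsClosed {k : FBLC E | R k = induced T k} :=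
          isClosed_eq R.continuous (induced T).continuous
        refine hcl.closure_subset (Metric.mem_closure_iff.2 fun ε hε => ?_)
        obtain ⟨_, ⟨g, hgA, rfl⟩, hg⟩ := h (ENNReal.ofReal ε) (ENNReal.ofReal_pos.2 hε)
        refine ⟨mk g 0, (iff g).1 hgA, ?_⟩
        rw [dist_eq_norm, ← mk_sub_zero]
        refine (norm_mk_zero_le _).trans_lt ?_
        rw [← ENNReal.toReal_ofReal hε.le]
        exact ENNReal.toReal_strict_mono ENNReal.ofReal_ne_top hg }
  -- Agreement on `δ_x` is the real part of `R (delta x) = induced T (delta x)`.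
  have hle := FBL_le hA fun x => ⟨⟨evalFn x, evalFn_mem_FBL x⟩, by
    have h1 := hδ x
    rw [← induced_delta T x] at h1
    refine Subtype.ext (funext fun φ => ?_)
    have h2 := congrArg (fun k : FBLC E => (k.toFun φ).re) h1
    have h3 : R (delta x) = _ := hS _ _
    rw [h3] at h2
    exact h2, rfl⟩
  have hSC : ∀ f, S f = C f := fun f => by
    obtain ⟨g, hg, hgf⟩ := hle f.2
    rw [← Subtype.ext hgf]
    exact hg
  ext h : 1
  have hh : h = mk ⟨_, h.2.1⟩ ⟨_, h.2.2⟩ := rfl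
  rw [hh, hS, induced_mk, hSC, hSC]

/-! ### Norms, invertibility and spectra -/

theorem norm_induced (T : E →L[ℂ] E) : ‖induced T‖ = ‖T‖ := by
  refine le_antisymm (LinearMap.mkContinuous_norm_le _ (norm_nonneg T) _) ?_
  refine T.opNorm_le_bound (norm_nonneg _) fun z => ?_
  rw [← norm_delta, ← induced_delta, ← norm_delta z]
  exact (induced T).le_opNorm _

/-- `T ↦ T̄` as a multiplicative map. -/
def inducedHom : (E →L[ℂ] E) →* (FBLC E →L[ℂ] FBLC E) where
  toFun := induced
  map_one' := rfl
  -- Taking adjoints and composing on the right each reverse products, so the order is preserved.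
  map_mul' _ _ := rfl

theorem induced_pow (T : E →L[ℂ] E) (n : ℕ) : induced (T ^ n) = induced T ^ n :=
  map_pow inducedHom T n

theorem norm_smul_sub_induced_delta (T : E →L[ℂ] E) (μ : ℂ) (z : E) :
    ‖μ • delta z - induced T (delta z)‖ = ‖μ • z - T z‖ := by
  rw [induced_delta, ← map_smul, ← map_sub, norm_delta]

end FBLC

/-- An invertible operator is bounded below. -/
theorem exists_pos_mul_norm_le_of_isUnit {V : Type*} [NormedAddCommGroup V] [NormedSpace ℂ V]
    {A : V →L[ℂ] V} (hA : IsUnit A) : ∃ α : ℝ, 0 < α ∧ ∀ v, α * ‖v‖ ≤ ‖A v‖ := by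
  obtain ⟨u, rfl⟩ := hA
  have hB : 0 < ‖(↑u⁻¹ : V →L[ℂ] V)‖ + 1 := by positivity
  refine ⟨(‖(↑u⁻¹ : V →L[ℂ] V)‖ + 1)⁻¹, inv_pos.2 hB, fun v => ?_⟩
  have hv : (↑u⁻¹ : V →L[ℂ] V) ((u : V →L[ℂ] V) v) = v := by
    rw [← mul_apply_eq_comp, Units.inv_mul, one_apply_eq_self]
  rw [inv_mul_le_iff₀ hB]
  have := (↑u⁻¹ : V →L[ℂ] V).le_opNorm ((u : V →L[ℂ] V) v)
  rw [hv] at this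
  nlinarith [norm_nonneg ((u : V →L[ℂ] V) v)]

/-- Membership in the spectrum is automatic, since invertible operators are bounded below. -/
theorem mem_approxPointSpectrum_iff {V : Type*} [NormedAddCommGroup V] [NormedSpace ℂ V]
    {A : V →L[ℂ] V} {μ : ℂ} :
    μ ∈ approxPointSpectrum A ↔
      ¬ ∃ α : ℝ, 0 < α ∧ ∀ v : V, α * ‖v‖ ≤ ‖μ • v - A v‖ := by
  refine ⟨fun h => h.2, fun h => ⟨fun hunit => h ?_, h⟩⟩
  exact exists_pos_mul_norm_le_of_isUnit hunit

/-- The annihilator of a proper closed subspace is nonzero. -/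
theorem exists_dual_vanishing_of_isClosed {V : Type*} [NormedAddCommGroup V] [NormedSpace ℂ V]
    {p : Submodule ℂ V} (hp : IsClosed (p : Set V)) {v : V} (hv : v ∉ p) :
    ∃ w : StrongDual ℂ V, w v ≠ 0 ∧ ∀ x ∈ p, w x = 0 := by
  have hv' : p.mkQL v ≠ 0 := fun h => hv ((Submodule.Quotient.mk_eq_zero p).1 h)
  obtain ⟨g, hg⟩ := SeparatingDual.exists_ne_zero (R := ℂ) hv'
  refine ⟨g.comp p.mkQL, hg, fun x hx => ?_⟩
  have : p.mkQL x = 0 := (Submodule.Quotient.mk_eq_zero p).2 hx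
  rw [ContinuousLinearMap.comp_apply, this, map_zero]

namespace FBLC

variable [CompleteSpace E]

theorem isUnit_of_isUnit_induced {T : E →L[ℂ] E} (h : IsUnit (induced T)) : IsUnit T := by
  obtain ⟨α, hα, hbelow⟩ := exists_pos_mul_norm_le_of_isUnit h
  have hanti : AntilipschitzWith (Real.toNNReal α⁻¹) T :=
    T.antilipschitz_of_bound fun z => by
      have := hbelow (delta z)
      rw [induced_delta, norm_delta, norm_delta] at this
      rwa [Real.coe_toNNReal _ (inv_pos.2 hα).le, ← div_eq_inv_mul, le_div_iff₀ hα, mul_comm]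
  have hclosed : IsClosed (LinearMap.range (T : E →ₗ[ℂ] E) : Set E) :=
    hanti.isClosed_range T.uniformContinuous
  refine ContinuousLinearMap.isUnit_iff_bijective.2 ⟨hanti.injective, fun v => ?_⟩
  by_contra hv
  obtain ⟨w, hwv, hw⟩ := exists_dual_vanishing_of_isClosed hclosed hv
  -- Hence any `T̄ h` takes at `Re w` the value `h 0`, which is 0 by homogeneity; `δ_E(v)` is such a
  -- `T̄ h`, yet `w v ≠ 0`.
  have hwT : (rePart w).comp (T.restrictScalars ℝ) = 0 := by
    ext x
    change (w (T x)).re = 0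
    rw [hw (T x) ⟨x, rfl⟩, Complex.zero_re]
  obtain ⟨u, hu⟩ := h
  have hsurj : induced T ((↑u⁻¹ : FBLC E →L[ℂ] FBLC E) (delta v)) = delta v := by
    rw [← hu, ← mul_apply_eq_comp, Units.mul_inv, one_apply_eq_self]
  apply hwv
  rw [← toFun_delta_rePart, ← hsurj, toFun_induced, hwT]
  simpa using toFun_smul_arg ((↑u⁻¹ : FBLC E →L[ℂ] FBLC E) (delta v)) le_rfl 0

theorem isUnit_induced_iff {T : E →L[ℂ] E} : IsUnit (induced T) ↔ IsUnit T :=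
  ⟨isUnit_of_isUnit_induced, fun h => h.map inducedHom⟩

theorem spectralRadius_induced (T : E →L[ℂ] E) :
    spectralRadius ℂ (induced T) = spectralRadius ℂ T := by
  refine tendsto_nhds_unique
    (spectrum.pow_nnnorm_pow_one_div_tendsto_nhds_spectralRadius (induced T)) ?_
  have hn : ∀ n : ℕ, ‖induced T ^ n‖₊ = ‖T ^ n‖₊ := fun n => by
    rw [← induced_pow]
    exact NNReal.eq (norm_induced _)
  simp only [hn]
  exact spectrum.pow_nnnorm_pow_one_div_tendsto_nhds_spectralRadius T

end FBLC

end Complex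

end FreeBanachLattice

end

open FreeBanachLattice in
theorem propositionp {E : Type*} [NormedAddCommGroup E] [NormedSpace ℂ E] [CompleteSpace E]
    (T : E →L[ℂ] E) :
    ∃ Tbar : FBLC E →L[ℂ] FBLC E,
      (FBLC.IsInduced T Tbar ∧ ∀ R : FBLC E →L[ℂ] FBLC E, FBLC.IsInduced T R → R = Tbar) ∧
      ‖Tbar‖ = ‖T‖ ∧
      approxPointSpectrum T ⊆ approxPointSpectrum Tbar ∧
      pointSpectrum T ⊆ pointSpectrum Tbar ∧
      ((0 : ℂ) ∈ spectrum ℂ T ↔ (0 : ℂ) ∈ spectrum ℂ Tbar) ∧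
      spectralRadius ℂ Tbar = spectralRadius ℂ T := by
  refine ⟨FBLC.induced T, ⟨FBLC.isInduced_induced T, fun R hR => hR.eq_induced⟩,
    FBLC.norm_induced T, fun μ hμ => ?_, fun μ hμ => ?_, ?_, FBLC.spectralRadius_induced T⟩
  · rw [mem_approxPointSpectrum_iff] at hμ ⊢
    rintro ⟨α, hα, h⟩
    refine hμ ⟨α, hα, fun z => ?_⟩
    rw [← FBLC.norm_smul_sub_induced_delta, ← FBLC.norm_delta z]
    exact h _
  · obtain ⟨z, hz, hz0⟩ := Module.End.HasEigenvalue.exists_hasEigenvector hμ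
    have hTz : T z = μ • z := Module.End.mem_eigenspace_iff.1 hz
    refine Module.End.hasEigenvalue_of_hasEigenvector (x := FBLC.delta z)
      ⟨Module.End.mem_eigenspace_iff.2 ?_, ?_⟩
    · change FBLC.induced T (FBLC.delta z) = _
      rw [FBLC.induced_delta, hTz, map_smul]
    · rwa [Ne, map_eq_zero_iff _ FBLC.delta_injective]
  · rw [spectrum.zero_mem_iff, spectrum.zero_mem_iff, FBLC.isUnit_induced_iff]
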